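/- Let $\Omega$ be a locally compact Hausdorff space, and let $E$ and $F$ be two Hilbert $C_0(\Omega)$-modules, where $C_0(\Omega)$ is the $C^*$-algebra of continuous complex-valued functions on $\Omega$ vanishing at infinity. Suppose that $F$ is full, that is, the linear span of $\{\langle f,g\rangle : f,g\in F\}$ is dense in $C_0(\Omega)$. Let $\theta:E\to F$ be a surjective $\mathbb{C}$-linear map (not assumed to be bounded) that is local ($\theta(e)a=0$ whenever $e\in E$, $a\in C_0(\Omega)$ and $ea=0$) and orthogonality preserving ($\langle\theta(x),\theta(y)\rangle=0$ whenever $x,y\in E$ and $\langle x,y\rangle=0$). Then $\theta$ is a bounded $C_0(\Omega)$-module homomorphism. Moreover, there exist a bounded continuous function $\psi:\Omega\to\mathbb{R}$ with $\psi(\omega)>0$ for all $\omega\in\Omega$, and a unitary $U:E\to F$ (a bounded $C_0(\Omega)$-module homomorphism with an adjoint $U^*:F\to E$ such that $U^*U=1_E$ and $UU^*=1_F$), such that $\theta=\psi\cdot U$, that is, $\theta(e)(\omega)=\psi(\omega)\,U(e)(\omega)$ for all $e\in E$ and $\omega\in\Omega$. Here $f(\omega)$, for $f\in F$, denotes the class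 of $f$ in the fibre $F/\{g\in F:\langle g,g\rangle(\omega)=0\}$. -/

import Mathlib

open scoped ZeroAtInfty BoundedContinuousFunction

/-- The order of the C⋆-algebra `C₀(Ω, ℂ)`: `f ≤ g` iff `g ω - f ω` is a nonnegative real number
for every `ω`. -/
instance ZeroAtInftyContinuousMap.instPartialOrderComplex {Ω : Type*} [TopologicalSpace Ω] :
    PartialOrder C₀(Ω, ℂ) where
  le f g := ∀ ω, Complex.partialOrder.le (f ω) (g ω)
  le_refl f ω := Complex.partialOrder.le_refl (f ω)
  le_trans f g h hfg hgh ω := Complex.partialOrder.le_trans _ _ _ (hfg ω) (hgh ω)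
  le_antisymm f g hfg hgf := DFunLike.ext f g fun ω =>
    Complex.partialOrder.le_antisymm _ _ (hfg ω) (hgf ω)

/- A Hilbert `C₀(Ω)`-module is a Banach space `E` with Mathlib's `CStarModule C₀(Ω, ℂ) E`. Since
`C₀(Ω)` is commutative, its action is written on the left. The axioms of the action (additivity,
associativity, compatibility with `ℂ`) follow from those of the definite inner product. -/

namespace HilbertC0

/-- Fullness: the linear span of the inner products is dense in `C₀(Ω)`. -/
def IsFull (Ω E : Type*) [TopologicalSpace Ω] [NormedAddCommGroup E] [NormedSpace ℂ E]
    [SMul C₀(Ω, ℂ) E] [CStarModule C₀(Ω, ℂ) E] : Prop :=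
  Dense (Submodule.span ℂ {f : C₀(Ω, ℂ) | ∃ x y : E, inner C₀(Ω, ℂ) x y = f} : Set C₀(Ω, ℂ))

section Maps

variable (Ω : Type*) {E F : Type*} [TopologicalSpace Ω]
  [NormedAddCommGroup E] [NormedSpace ℂ E] [SMul C₀(Ω, ℂ) E]
  [NormedAddCommGroup F] [NormedSpace ℂ F] [SMul C₀(Ω, ℂ) F]

/-- A linear map is local if `θ(e)a = 0` whenever `ea = 0`. -/
def IsLocal (θ : E →ₗ[ℂ] F) : Prop :=
  ∀ (e : E) (a : C₀(Ω, ℂ)), a • e = 0 → a • θ e = 0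

variable (E F) in
/-- The set of bounded `C₀(Ω)`-module homomorphisms among all linear maps `E → F`. -/
def boundedModuleHoms : Set (E →ₗ[ℂ] F) :=
  {T | (∃ C : ℝ, ∀ x : E, ‖T x‖ ≤ C * ‖x‖) ∧ ∀ (a : C₀(Ω, ℂ)) (x : E), T (a • x) = a • T x}

variable [CStarModule C₀(Ω, ℂ) E] [CStarModule C₀(Ω, ℂ) F]

/-- `⟨θ x, θ y⟩ = 0` whenever `⟨x, y⟩ = 0`. -/
def PreservesOrthogonality (θ : E →ₗ[ℂ] F) : Prop :=
  ∀ x y : E, inner C₀(Ω, ℂ) x y = 0 → inner C₀(Ω, ℂ) (θ x) (θ y) = 0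

/-- A unitary between Hilbert modules: a bounded module homomorphism `U` with an adjoint `V` such
that `VU = 1` and `UV = 1`. -/
def IsUnitary (U : E →ₗ[ℂ] F) : Prop :=
  U ∈ boundedModuleHoms Ω E F ∧
    ∃ V ∈ boundedModuleHoms Ω F E,
      (∀ (x : E) (y : F), inner C₀(Ω, ℂ) (U x) y = inner C₀(Ω, ℂ) x (V y)) ∧
      V ∘ₗ U = LinearMap.id ∧ U ∘ₗ V = LinearMap.id

end Maps

section Fibres

variable {Ω : Type*} (E : Type*) [TopologicalSpace Ω] [NormedAddCommGroup E] [NormedSpace ℂ E]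
  [SMul C₀(Ω, ℂ) E] [CStarModule C₀(Ω, ℂ) E]

/-- The submodule of all `f` that vanish at `ω`, that is, with `⟨f, f⟩(ω) = 0`. -/
def vanishingAt (ω : Ω) : Submodule ℂ E where
  carrier := {f | inner C₀(Ω, ℂ) f f ω = 0}
  zero_mem' := by simp
  add_mem' := by
    intro f g hf hg
    simp only [Set.mem_ofPred_eq] at hf hg ⊢
    -- parallelogram law, and both terms on its left-hand side are nonnegative
    have h1 := (CStarModule.inner_self_nonneg (A := C₀(Ω, ℂ)) (x := f + g)) ω
    have h2 := (CStarModule.inner_self_nonneg (A := C₀(Ω, ℂ)) (x := f - g)) ω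
    have h3 : inner C₀(Ω, ℂ) (f + g) (f + g) ω + inner C₀(Ω, ℂ) (f - g) (f - g) ω = 0 := by
      simp only [CStarModule.inner_add_right, CStarModule.inner_add_left,
        CStarModule.inner_sub_right, CStarModule.inner_sub_left,
        ZeroAtInftyContinuousMap.add_apply, ZeroAtInftyContinuousMap.sub_apply]
      linear_combination 2 * hf + 2 * hg
    obtain ⟨h1r, h1i⟩ := h1
    obtain ⟨h2r, h2i⟩ := h2
    simp only [ZeroAtInftyContinuousMap.zero_apply, Complex.zero_re, Complex.zero_im] at *
    have h4 := congrArg Complex.re h3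
    simp only [Complex.add_re, Complex.zero_re] at h4
    exact Complex.ext (by simp only [Complex.zero_re]; linarith) (by simpa using h1i.symm)
  smul_mem' := by
    intro c f hf
    simp only [Set.mem_ofPred_eq] at hf ⊢
    simp [hf]

/-- The fibre at `ω` of the Hilbert bundle of `E`. -/
abbrev Fibre (ω : Ω) : Type _ := E ⧸ vanishingAt E ω

variable {E}

/-- The value `f(ω)` of `f`, viewed as a section of the Hilbert bundle of `E`. -/
def value (f : E) (ω : Ω) : Fibre E ω := (vanishingAt E ω).mkQ f

end Fibres

end HilbertC0

open Filter Topology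

/-! Elements of a Hilbert `C₀(Ω)`-module are sections of a field of Hilbert spaces, and the norm is
the supremum of the fibre norms. The crux is that locality alone, without boundedness, lets `θ`
descend to the fibres (`IsLocal.normSqAt_eq_zero`). If `e(ω) = 0` but `θ(e)(ω) ≠ 0`, then `e` is
nonzero at points arbitrarily near `ω`. Multiply `e` by a step-like function of `|e|^(-1/2)`: the
product is still in `E`, yet where the multiplier is locally constant, locality makes `θ` of the
product equal to a huge constant times `θ(e)`, contradicting finiteness of its norm.

Each fibre map preserves orthogonality, hence is a multiple `ψ(ω)` of an isometry
(`PreservesOrthogonality.normSqAt_mul`). Fullness and surjectivity make `ψ` positive and continuous.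
The closed graph theorem bounds `θ`, hence `ψ` from above; the open mapping theorem bounds `ψ` away
from zero. So `U = ψ⁻¹θ` maps into `F`, and it is unitary by polarization. -/

namespace HilbertC0

/-! ### Fibrewise norms, inner products and values -/

section Pointwise

variable {Ω E : Type*} [TopologicalSpace Ω] [NormedAddCommGroup E] [NormedSpace ℂ E]
  [SMul C₀(Ω, ℂ) E] [CStarModule C₀(Ω, ℂ) E]

/-- The squared norm of the value `e(ω)` in the fibre at `ω`. -/
noncomputable def normSqAt (e : E) (ω : Ω) : ℝ := (inner C₀(Ω, ℂ) e e ω).re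

lemma inner_self_apply (e : E) (ω : Ω) : inner C₀(Ω, ℂ) e e ω = (normSqAt e ω : ℂ) := by
  have h := (CStarModule.inner_self_nonneg (A := C₀(Ω, ℂ)) (x := e)) ω
  exact Complex.ext rfl (by simpa using h.2.symm)

lemma normSqAt_nonneg (e : E) (ω : Ω) : 0 ≤ normSqAt e ω := by
  have h := (CStarModule.inner_self_nonneg (A := C₀(Ω, ℂ)) (x := e)) ω
  exact h.1

lemma inner_star_apply (x y : E) (ω : Ω) :
    inner C₀(Ω, ℂ) x y ω = star (inner C₀(Ω, ℂ) y x ω) := by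
  rw [← ZeroAtInftyContinuousMap.star_apply, CStarModule.star_inner]

lemma continuous_normSqAt (e : E) : Continuous (normSqAt e : Ω → ℝ) :=
  Complex.continuous_re.comp (map_continuous (inner C₀(Ω, ℂ) e e))

lemma tendsto_normSqAt_cocompact (e : E) :
    Tendsto (normSqAt e : Ω → ℝ) (cocompact Ω) (𝓝 0) := by
  exact (Complex.continuous_re.tendsto 0).comp
    (ZeroAtInftyContinuousMapClass.zero_at_infty (inner C₀(Ω, ℂ) e e))

lemma norm_apply_le_norm (f : C₀(Ω, ℂ)) (ω : Ω) : ‖f ω‖ ≤ ‖f‖ := by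
  rw [← ZeroAtInftyContinuousMap.norm_toBCF_eq_norm]
  exact f.toBCF.norm_coe_le_norm ω

variable (Ω) in
lemma norm_sq_eq_norm_inner (e : E) : ‖e‖ ^ 2 = ‖inner C₀(Ω, ℂ) e e‖ := by
  rw [CStarModule.norm_eq_sqrt_norm_inner_self (A := C₀(Ω, ℂ)) e, Real.sq_sqrt (norm_nonneg _)]

lemma normSqAt_le_norm_sq (e : E) (ω : Ω) : normSqAt e ω ≤ ‖e‖ ^ 2 := by
  rw [norm_sq_eq_norm_inner Ω e]
  exact (Complex.re_le_norm _).trans (norm_apply_le_norm _ ω)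

variable (Ω) in
lemma norm_sq_le_of_normSqAt_le {e : E} {C : ℝ} (hC : 0 ≤ C) (h : ∀ ω : Ω, normSqAt e ω ≤ C) :
    ‖e‖ ^ 2 ≤ C := by
  rw [norm_sq_eq_norm_inner Ω e, ← ZeroAtInftyContinuousMap.norm_toBCF_eq_norm]
  refine (BoundedContinuousFunction.norm_le hC).2 fun ω => ?_
  change ‖inner C₀(Ω, ℂ) e e ω‖ ≤ C
  rw [inner_self_apply, Complex.norm_real, Real.norm_of_nonneg (normSqAt_nonneg e ω)]
  exact h ω

lemma normSqAt_add (x y : E) (ω : Ω) :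
    normSqAt (x + y) ω = normSqAt x ω + normSqAt y ω + 2 * (inner C₀(Ω, ℂ) x y ω).re := by
  have h : (inner C₀(Ω, ℂ) y x ω).re = (inner C₀(Ω, ℂ) x y ω).re := by
    rw [inner_star_apply y x]; simp
  simp only [normSqAt, CStarModule.inner_add_right, CStarModule.inner_add_left,
    ZeroAtInftyContinuousMap.add_apply, Complex.add_re, h]
  ring

lemma normSqAt_smul (c : ℂ) (x : E) (ω : Ω) : normSqAt (c • x) ω = ‖c‖ ^ 2 * normSqAt x ω := by
  have h : inner C₀(Ω, ℂ) (c • x) (c • x) ω = (‖c‖ ^ 2 : ℝ) * (normSqAt x ω : ℂ) := by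
    simp only [CStarModule.inner_smul_right_complex, CStarModule.inner_smul_left_complex,
      ZeroAtInftyContinuousMap.smul_apply, smul_eq_mul, inner_self_apply, ← mul_assoc]
    congr 1
    simpa using RCLike.mul_conj c
  rw [normSqAt, h, ← Complex.ofReal_mul, Complex.ofReal_re]

lemma normSqAt_neg (x : E) (ω : Ω) : normSqAt (-x) ω = normSqAt x ω := by
  simp [normSqAt]

lemma normSqAt_add_le (x y : E) (ω : Ω) :
    normSqAt (x + y) ω ≤ 2 * normSqAt x ω + 2 * normSqAt y ω := by
  have h₁ := normSqAt_add x y ω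
  have h₂ := normSqAt_add x (-y) ω
  have h₃ := normSqAt_nonneg (x + -y) ω
  simp only [normSqAt_neg, CStarModule.inner_neg_right, ZeroAtInftyContinuousMap.neg_apply,
    Complex.neg_re] at h₂
  linarith

variable (E) in
/-- The positive semidefinite inner product on `E` given by evaluation at `ω`. -/
@[reducible] noncomputable def preInnerCoreAt (ω : Ω) : PreInnerProductSpace.Core ℂ E where
  inner x y := inner C₀(Ω, ℂ) x y ω
  conj_inner_symm x y := (inner_star_apply x y ω).symm
  re_inner_nonneg x := normSqAt_nonneg x ω
  add_left x y z := by simp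
  smul_left x y c := by simp

lemma inner_apply_eq_zero_of_left {x : E} {ω : Ω} (hx : normSqAt x ω = 0) (y : E) :
    inner C₀(Ω, ℂ) x y ω = 0 := by
  have h : ‖inner C₀(Ω, ℂ) x y ω‖ * ‖inner C₀(Ω, ℂ) y x ω‖ ≤ normSqAt x ω * normSqAt y ω :=
    @InnerProductSpace.Core.inner_mul_inner_self_le ℂ E _ _ _ (preInnerCoreAt E ω) x y
  rw [inner_star_apply y x, norm_star, hx, zero_mul] at h
  exact norm_eq_zero.1 (mul_self_eq_zero.1 (le_antisymm h (mul_self_nonneg _)))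

lemma inner_apply_eq_zero_of_right (x : E) {y : E} {ω : Ω} (hy : normSqAt y ω = 0) :
    inner C₀(Ω, ℂ) x y ω = 0 := by
  rw [inner_star_apply, inner_apply_eq_zero_of_left hy, star_zero]

lemma value_eq_iff {x y : E} {ω : Ω} : value x ω = value y ω ↔ normSqAt (x - y) ω = 0 := by
  change (Submodule.Quotient.mk x : Fibre E ω) = Submodule.Quotient.mk y ↔ _
  rw [Submodule.Quotient.eq]
  change inner C₀(Ω, ℂ) (x - y) (x - y) ω = 0 ↔ _
  rw [inner_self_apply, Complex.ofReal_eq_zero]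

lemma value_add (x y : E) (ω : Ω) : value (x + y) ω = value x ω + value y ω :=
  map_add _ x y

lemma value_sub (x y : E) (ω : Ω) : value (x - y) ω = value x ω - value y ω :=
  map_sub _ x y

lemma value_smul (c : ℂ) (x : E) (ω : Ω) : value (c • x) ω = c • value x ω :=
  map_smul _ c x

lemma value_zero (ω : Ω) : value (0 : E) ω = 0 :=
  map_zero _

lemma value_eq_zero_iff {x : E} {ω : Ω} : value x ω = 0 ↔ normSqAt x ω = 0 := by
  rw [← value_zero, value_eq_iff, sub_zero]

lemma value_module_smul (a : C₀(Ω, ℂ)) (x : E) (ω : Ω) : value (a • x) ω = a ω • value x ω := by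
  rw [← value_smul, value_eq_iff]
  have h : inner C₀(Ω, ℂ) (a • x - a ω • x) (a • x - a ω • x) ω = 0 := by
    simp only [CStarModule.inner_sub_right, CStarModule.inner_sub_left,
      CStarModule.inner_smul_right_complex, CStarModule.inner_smul_left_complex,
      CStarModule.inner_op_smul_right, CStarModule.inner_op_smul_left,
      ZeroAtInftyContinuousMap.sub_apply, ZeroAtInftyContinuousMap.mul_apply,
      ZeroAtInftyContinuousMap.smul_apply, ZeroAtInftyContinuousMap.star_apply, smul_eq_mul]
    ring
  rw [normSqAt, h, Complex.zero_re]

variable (Ω) in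
-- The norm is controlled by the supremum of the fibre norms, so a section is determined by its
-- values.
lemma ext_value {x y : E} (h : ∀ ω : Ω, value x ω = value y ω) : x = y := by
  rw [← sub_eq_zero, ← norm_eq_zero, ← sq_eq_zero_iff]
  exact le_antisymm (norm_sq_le_of_normSqAt_le Ω le_rfl fun ω => (value_eq_iff.1 (h ω)).le)
    (sq_nonneg _)

lemma inner_apply_congr {x x' y y' : E} {ω : Ω} (hx : value x ω = value x' ω)
    (hy : value y ω = value y' ω) : inner C₀(Ω, ℂ) x y ω = inner C₀(Ω, ℂ) x' y' ω := by
  have h₁ := inner_apply_eq_zero_of_left (value_eq_iff.1 hx) y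
  have h₂ := inner_apply_eq_zero_of_right x' (value_eq_iff.1 hy)
  simp only [CStarModule.inner_sub_left, CStarModule.inner_sub_right,
    ZeroAtInftyContinuousMap.sub_apply] at h₁ h₂
  linear_combination h₁ + h₂

lemma normSqAt_congr {x y : E} {ω : Ω} (h : value x ω = value y ω) :
    normSqAt x ω = normSqAt y ω := by
  rw [normSqAt, inner_apply_congr h h, normSqAt]

lemma normSqAt_of_value_eq_smul {x y : E} {ω : Ω} {c : ℂ} (h : value x ω = c • value y ω) :
    normSqAt x ω = ‖c‖ ^ 2 * normSqAt y ω := by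
  rw [← value_smul] at h
  rw [normSqAt_congr h, normSqAt_smul]

lemma normSqAt_of_value_eq_real_smul {x y : E} {ω : Ω} {c : ℝ}
    (h : value x ω = (c : ℂ) • value y ω) : normSqAt x ω = c ^ 2 * normSqAt y ω := by
  rw [normSqAt_of_value_eq_smul h, Complex.norm_real, Real.norm_eq_abs, sq_abs]

end Pointwise

/-! ### Multiplying sections by continuous functions outside `C₀(Ω)` -/

section Multiplier

variable {Ω E : Type*} [TopologicalSpace Ω] [NormedAddCommGroup E] [NormedSpace ℂ E]
  [SMul C₀(Ω, ℂ) E] [CStarModule C₀(Ω, ℂ) E]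

/-- Cutting off a function near the zero set of `e` gives an element of `C₀(Ω)`. -/
lemma exists_cutoff (e : E) {g : Ω → ℝ} (hg : ContinuousOn g {ω | normSqAt e ω ≠ 0})
    {χ : ℝ → ℝ} (hχ : Continuous χ) {δ : ℝ} (hδ : 0 < δ) (hχδ : ∀ t < δ, χ t = 0) :
    ∃ a : C₀(Ω, ℂ), ∀ ω, a ω = ((χ (normSqAt e ω) * g ω : ℝ) : ℂ) := by
  have hN := continuous_normSqAt (Ω := Ω) e
  have hcont : Continuous fun ω => χ (normSqAt e ω) * g ω := by
    rw [continuous_iff_continuousAt]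
    intro ω
    by_cases hω : normSqAt e ω = 0
    · have hev : (fun _ => (0 : ℝ)) =ᶠ[𝓝 ω] fun ω => χ (normSqAt e ω) * g ω := by
        filter_upwards [hN.continuousAt.eventually_lt_const (hω.trans_lt hδ)] with η hη
        rw [hχδ _ hη, zero_mul]
      exact continuousAt_const.congr hev
    · exact (hχ.comp hN).continuousAt.mul
        (hg.continuousAt ((isOpen_ne_fun hN continuous_const).mem_nhds hω))
  refine ⟨⟨⟨fun ω => ((χ (normSqAt e ω) * g ω : ℝ) : ℂ), Complex.continuous_ofReal.comp hcont⟩,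
    ?_⟩, fun ω => rfl⟩
  refine tendsto_const_nhds.congr' ?_
  filter_upwards [(tendsto_normSqAt_cocompact e).eventually_lt_const hδ] with η hη
  simp [hχδ _ hη]

/-- A section `g · e` belongs to the module as soon as `g` is continuous where `e` does not vanish
and `g · e` is small where `e` is small. -/
lemma exists_value_eq_smul [CompleteSpace E] (e : E) {g : Ω → ℝ}
    (hg : ContinuousOn g {ω | normSqAt e ω ≠ 0})
    (hsmall : ∀ ε > 0, ∃ δ > 0, ∀ ω, normSqAt e ω < δ → g ω ^ 2 * normSqAt e ω ≤ ε) :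
    ∃ x : E, ∀ ω, value x ω = (g ω : ℂ) • value e ω := by
  -- `χ n` vanishes up to `1/(n+1)` and is `1` from `2/(n+1)` on. Hence `χ n (|e|²) g` lies in
  -- `C₀(Ω)`, and its products with `e` are Cauchy: for large indices they differ only where `|e|² <
  -- δ`, where `g · e` is small.
  let χ : ℕ → ℝ → ℝ := fun n t => max 0 (min 1 ((n + 1) * t - 1))
  have hχ0 : ∀ n t, 0 ≤ χ n t := fun n t => le_max_left _ _
  have hχ1 : ∀ n t, χ n t ≤ 1 := fun n t => max_le zero_le_one (min_le_left _ _)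
  have hχone : ∀ δ > 0, ∃ n₀ : ℕ, ∀ n ≥ n₀, ∀ t ≥ δ, χ n t = 1 := by
    intro δ hδ
    obtain ⟨n₀, hn₀⟩ := exists_nat_gt (2 / δ)
    refine ⟨n₀, fun n hn t ht => ?_⟩
    rw [div_lt_iff₀ hδ] at hn₀
    have hn' : (n₀ : ℝ) ≤ n := Nat.cast_le.2 hn
    have h : 1 ≤ ((n : ℝ) + 1) * t - 1 := by nlinarith
    simp only [χ, min_eq_left h, max_eq_right zero_le_one]
  have hcut : ∀ n : ℕ, ∃ a : C₀(Ω, ℂ), ∀ ω, a ω = ((χ n (normSqAt e ω) * g ω : ℝ) : ℂ) := by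
    intro n
    refine exists_cutoff e hg (by fun_prop) (δ := 1 / (n + 1)) (by positivity) fun t ht => ?_
    rw [lt_div_iff₀ (by positivity)] at ht
    exact max_eq_left ((min_le_right _ _).trans (by linarith))
  choose a ha using hcut
  have hdiff : ∀ n m ω, normSqAt (a n • e - a m • e) ω
      = ((χ n (normSqAt e ω) - χ m (normSqAt e ω)) * g ω) ^ 2 * normSqAt e ω := by
    intro n m ω
    refine normSqAt_of_value_eq_real_smul ?_
    rw [value_sub, value_module_smul, value_module_smul, ← sub_smul, ha, ha]
    push_cast
    rw [sub_mul]
  have hcau : CauchySeq fun n => a n • e := by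
    rw [Metric.cauchySeq_iff']
    intro ε hε
    obtain ⟨δ, hδ, hδε⟩ := hsmall ((ε / 2) ^ 2) (by positivity)
    obtain ⟨n₀, hn₀⟩ := hχone δ hδ
    refine ⟨n₀, fun n hn => ?_⟩
    have hle : ‖a n • e - a n₀ • e‖ ^ 2 ≤ (ε / 2) ^ 2 := by
      refine norm_sq_le_of_normSqAt_le Ω (by positivity) fun ω => ?_
      rw [hdiff]
      rcases lt_or_ge (normSqAt e ω) δ with h | h
      · refine le_trans ?_ (hδε ω h)
        rw [mul_pow]
        have h₁ : (χ n (normSqAt e ω) - χ n₀ (normSqAt e ω)) ^ 2 ≤ 1 := by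
          rw [sq_le_one_iff_abs_le_one, abs_le]
          constructor <;> linarith [hχ0 n (normSqAt e ω), hχ0 n₀ (normSqAt e ω),
            hχ1 n (normSqAt e ω), hχ1 n₀ (normSqAt e ω)]
        exact mul_le_mul_of_nonneg_right (mul_le_of_le_one_left (sq_nonneg _) h₁)
          (normSqAt_nonneg e ω)
      · rw [hn₀ n hn _ h, hn₀ n₀ le_rfl _ h]
        simp only [sub_self, zero_mul, ne_eq, OfNat.ofNat_ne_zero, not_false_eq_true, zero_pow]
        positivity
    rw [dist_eq_norm]
    have := abs_le_of_sq_le_sq hle (by positivity)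
    linarith [le_abs_self ‖a n • e - a n₀ • e‖]
  obtain ⟨x, hx⟩ := cauchySeq_tendsto_of_complete hcau
  refine ⟨x, fun ω => ?_⟩
  -- At a fixed `ω` the approximants eventually have exactly the desired value, so the norm limit
  -- has it too.
  have heq : ∀ᶠ n in atTop, value (a n • e) ω = (g ω : ℂ) • value e ω := by
    rcases (normSqAt_nonneg e ω).eq_or_lt with h | h
    · refine Eventually.of_forall fun n => ?_
      rw [value_module_smul, value_eq_zero_iff.2 h.symm, smul_zero, smul_zero]
    · obtain ⟨n₀, hn₀⟩ := hχone _ h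
      filter_upwards [eventually_ge_atTop n₀] with n hn
      rw [value_module_smul, ha, hn₀ n hn _ le_rfl, one_mul]
  rw [← value_smul, value_eq_iff]
  refine le_antisymm (ge_of_tendsto (x := atTop) (f := fun n => ‖x - a n • e‖ ^ 2) ?_ ?_)
    (normSqAt_nonneg _ ω)
  · have := ((tendsto_const_nhds (x := x)).sub hx).norm.pow 2
    simpa using this
  · filter_upwards [heq] with n hn
    rw [← value_smul] at hn
    refine le_trans (le_of_eq (normSqAt_congr ?_)) (normSqAt_le_norm_sq _ ω)
    rw [value_sub, value_sub, hn]

/-- The module is closed under multiplication by bounded continuous functions. -/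
lemma exists_value_eq_smul_of_bounded [CompleteSpace E] (e : E) {g : Ω → ℝ} (hg : Continuous g)
    {C : ℝ} (hC : ∀ ω, |g ω| ≤ C) : ∃ x : E, ∀ ω, value x ω = (g ω : ℂ) • value e ω := by
  refine exists_value_eq_smul e hg.continuousOn fun ε hε =>
    ⟨ε / (C ^ 2 + 1), by positivity, fun ω hω => ?_⟩
  rw [lt_div_iff₀ (by positivity)] at hω
  have h₁ : g ω ^ 2 ≤ C ^ 2 := by
    rw [← sq_abs]
    exact pow_le_pow_left₀ (abs_nonneg _) (hC ω) 2
  nlinarith [normSqAt_nonneg e ω]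

/-- A section that does not vanish at `ω` can be rescaled to attain its norm there. -/
lemma exists_norm_sq_le_normSqAt [CompleteSpace E] {e : E} {ω : Ω} (he : 0 < normSqAt e ω) :
    ∃ x : E, 0 < normSqAt x ω ∧ ‖x‖ ^ 2 ≤ normSqAt x ω := by
  have hN := continuous_normSqAt (Ω := Ω) e
  set r := normSqAt e ω
  have hpos : ∀ η : Ω, 0 < max r (normSqAt e η) := fun η => lt_max_of_lt_left he
  have hdiv : ∀ η : Ω, 0 ≤ r / max r (normSqAt e η) := fun η => (div_pos he (hpos η)).le
  -- The multiplier is `1` at `ω` and truncates the squared fibre norm to `min r |e(η)|²`.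
  obtain ⟨x, hx⟩ := exists_value_eq_smul_of_bounded (Ω := Ω) e
    (g := fun η => √(r / max r (normSqAt e η))) (C := 1)
    (Real.continuous_sqrt.comp (continuous_const.div (continuous_const.max hN)
      fun η => (hpos η).ne'))
    (fun η => by
      rw [abs_of_nonneg (Real.sqrt_nonneg _), Real.sqrt_le_one, div_le_one (hpos η)]
      exact le_max_left _ _)
  have hval : ∀ η, normSqAt x η = r / max r (normSqAt e η) * normSqAt e η := fun η => by
    rw [normSqAt_of_value_eq_real_smul (hx η), Real.sq_sqrt (hdiv η)]
  have hxω : normSqAt x ω = r := by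
    rw [hval, max_self, div_self he.ne', one_mul]
  refine ⟨x, hxω ▸ he, hxω ▸ norm_sq_le_of_normSqAt_le Ω he.le fun η => ?_⟩
  rw [hval, div_mul_eq_mul_div, div_le_iff₀ (hpos η)]
  exact mul_le_mul_of_nonneg_left (le_max_right _ _) he.le

end Multiplier

/-! ### An unbounded multiplier with plateaus -/

section Staircase

/-- A continuous function close to the identity that is constant on each `[n, n + 2/3]`. -/
noncomputable def staircase (u : ℝ) : ℝ :=
  u + (max 0 (3 * Int.fract u - 2) - Int.fract u)

lemma continuous_staircase : Continuous staircase := by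
  have h : Continuous ((fun v : ℝ => max 0 (3 * v - 2) - v) ∘ Int.fract) :=
    -- The function of the fractional part takes the value `0` at both `0` and `1`, so there is no
    -- jump at the integers.
    ContinuousOn.comp_fract'' (by fun_prop) (by norm_num)
  exact continuous_id.add h

lemma sub_one_le_staircase (u : ℝ) : u - 1 ≤ staircase u := by
  have h := Int.fract_lt_one u
  have := le_max_left 0 (3 * Int.fract u - 2)
  unfold staircase
  linarith

lemma staircase_le (u : ℝ) : staircase u ≤ u := by
  have h₀ := Int.fract_nonneg u
  have h₁ := Int.fract_lt_one u
  have : max 0 (3 * Int.fract u - 2) ≤ Int.fract u := max_le h₀ (by linarith)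
  unfold staircase
  linarith

lemma staircase_eq_floor {u : ℝ} (h : Int.fract u ≤ 2 / 3) : staircase u = ⌊u⌋ := by
  rw [staircase, max_eq_left (by linarith), ← Int.self_sub_fract]
  ring

lemma eventually_staircase_eq {u : ℝ} (h₀ : 0 < Int.fract u) (h₁ : Int.fract u < 2 / 3) :
    ∀ᶠ v in 𝓝 u, staircase v = staircase u := by
  have hu := Int.floor_add_fract u
  have hmem : Set.Ioo (⌊u⌋ : ℝ) (⌊u⌋ + 2 / 3) ∈ 𝓝 u := Ioo_mem_nhds (by linarith) (by linarith)
  filter_upwards [hmem] with v hv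
  have hfl : ⌊v⌋ = ⌊u⌋ := Int.floor_eq_iff.2 ⟨hv.1.le, by linarith [hv.2]⟩
  have hv' : Int.fract v ≤ 2 / 3 := by
    rw [← Int.self_sub_floor, hfl]
    linarith [hv.2]
  rw [staircase_eq_floor hv', staircase_eq_floor h₁.le, hfl]

/-- The plateaus fill two thirds of each period, so a shift by half a period carries every point off
their interiors into one. -/
lemma eventually_staircase_eq_or (u : ℝ) :
    (∀ᶠ v in 𝓝 (u + 0), staircase v = staircase (u + 0)) ∨
      ∀ᶠ v in 𝓝 (u + 1 / 2), staircase v = staircase (u + 1 / 2) := by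
  by_cases h : 0 < Int.fract u ∧ Int.fract u < 2 / 3
  · left
    rw [add_zero]
    exact eventually_staircase_eq h.1 h.2
  · right
    have hu := Int.floor_add_fract u
    have h₀ := Int.fract_nonneg u
    have h₁ := Int.fract_lt_one u
    rcases h₀.eq_or_lt with h₂ | h₂
    · have hfr : Int.fract (u + 1 / 2) = 1 / 2 :=
        Int.fract_eq_iff.2 ⟨by norm_num, by norm_num, ⌊u⌋, by linarith⟩
      exact eventually_staircase_eq (by rw [hfr]; norm_num) (by rw [hfr]; norm_num)
    · have h₃ : 2 / 3 ≤ Int.fract u := not_lt.1 fun h₄ => h ⟨h₂, h₄⟩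
      have hfr : Int.fract (u + 1 / 2) = Int.fract u - 1 / 2 :=
        Int.fract_eq_iff.2 ⟨by linarith, by linarith, ⌊u⌋ + 1, by push_cast; linarith⟩
      exact eventually_staircase_eq (by rw [hfr]; linarith) (by rw [hfr]; linarith)

/-- Multiplying by an unbounded staircase function of the norm of `e`. -/
lemma exists_value_eq_staircase_smul {Ω E : Type*} [TopologicalSpace Ω] [NormedAddCommGroup E]
    [NormedSpace ℂ E] [CompleteSpace E] [SMul C₀(Ω, ℂ) E] [CStarModule C₀(Ω, ℂ) E] (e : E)
    {c : ℝ} (hc₀ : 0 ≤ c) (hc₁ : c ≤ 1) :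
    ∃ x : E, ∀ ω : Ω,
      value x ω = (staircase ((√√(normSqAt e ω))⁻¹ + c) : ℂ) • value e ω := by
  have hN := continuous_normSqAt (Ω := Ω) e
  -- With `r = |e|^(1/2)`, the bound `1` gives `r ≤ 1`, so the multiplier times `r` is at most `1 +
  -- c r ≤ 2`. The bound `(ε/9)²` gives `r² ≤ ε/9`, so the squared norm of the product is at most
  -- `4ε/9`.
  refine exists_value_eq_smul e ?_ fun ε hε => ⟨min 1 ((ε / 9) ^ 2), by positivity, fun ω hω => ?_⟩
  · refine continuous_staircase.comp_continuousOn (ContinuousOn.add (ContinuousOn.inv₀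
      (by fun_prop) fun ω hω => ?_) continuousOn_const)
    have := lt_of_le_of_ne (normSqAt_nonneg e ω) (Ne.symm hω)
    positivity
  · obtain ⟨h₁, h₂⟩ := lt_min_iff.1 hω
    rcases (normSqAt_nonneg e ω).eq_or_lt with h | h
    · rw [← h, mul_zero]
      exact hε.le
    set r := √√(normSqAt e ω)
    have hr : 0 < r := by positivity
    have hr2 : r ^ 2 = √(normSqAt e ω) := Real.sq_sqrt (Real.sqrt_nonneg _)
    have hr4 : normSqAt e ω = r ^ 2 * r ^ 2 := by
      rw [hr2, Real.mul_self_sqrt h.le]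
    have hr1 : r ≤ 1 := by
      rw [Real.sqrt_le_one, Real.sqrt_le_one]
      exact h₁.le
    have hrε : r ^ 2 ≤ ε / 9 := by
      rw [hr2]
      exact Real.sqrt_le_iff.2 ⟨by positivity, h₂.le⟩
    have hinv : r⁻¹ * r = 1 := inv_mul_cancel₀ hr.ne'
    have hinv1 : 1 ≤ r⁻¹ := (one_le_inv₀ hr).2 hr1
    have hs₀ : 0 ≤ staircase (r⁻¹ + c) := by
      linarith [sub_one_le_staircase (r⁻¹ + c)]
    have hs : staircase (r⁻¹ + c) * r ≤ 2 := by
      calc staircase (r⁻¹ + c) * r ≤ (r⁻¹ + c) * r :=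
            mul_le_mul_of_nonneg_right (staircase_le _) hr.le
        _ = 1 + c * r := by rw [add_mul, hinv]
        _ ≤ 2 := by nlinarith
    calc staircase (r⁻¹ + c) ^ 2 * normSqAt e ω
        = (staircase (r⁻¹ + c) * r) ^ 2 * r ^ 2 := by rw [hr4]; ring
      _ ≤ 2 ^ 2 * (ε / 9) := by gcongr
      _ ≤ ε := by linarith

end Staircase

/-! ### Local maps act fibrewise; nonvanishing of full modules -/

lemma exists_zeroAtInfty_bump {Ω : Type*} [TopologicalSpace Ω] [LocallyCompactSpace Ω]
    [T2Space Ω] {ω : Ω} {s : Set Ω} (hs : s ∈ 𝓝 ω) :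
    ∃ a : C₀(Ω, ℂ), a ω = 1 ∧ ∀ η ∉ s, a η = 0 := by
  obtain ⟨f, hf₁, hf₀, hfc, -⟩ := exists_continuous_one_zero_of_isCompact
    (isCompact_singleton (x := ω)) isOpen_interior.isClosed_compl
    (Set.disjoint_compl_right_iff_subset.2
      (Set.singleton_subset_iff.2 (mem_interior_iff_mem_nhds.2 hs)))
  have hlim : Tendsto (fun η => (f η : ℂ)) (cocompact Ω) (𝓝 0) := by
    rw [← Complex.ofReal_zero]
    exact (Complex.continuous_ofReal.tendsto 0).comp hfc.is_zero_at_infty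
  refine ⟨⟨⟨fun η => (f η : ℂ), by fun_prop⟩, hlim⟩, ?_, fun η hη => ?_⟩
  · change ((f ω : ℝ) : ℂ) = 1
    rw [hf₁ rfl]
    simp
  · change ((f η : ℝ) : ℂ) = 0
    rw [hf₀ fun h => hη (interior_subset h)]
    simp

section Local

variable {Ω E F : Type*} [TopologicalSpace Ω] [LocallyCompactSpace Ω] [T2Space Ω]
  [NormedAddCommGroup E] [NormedSpace ℂ E] [SMul C₀(Ω, ℂ) E] [CStarModule C₀(Ω, ℂ) E]
  [NormedAddCommGroup F] [NormedSpace ℂ F] [SMul C₀(Ω, ℂ) F] [CStarModule C₀(Ω, ℂ) F]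

/-- A bump function `a` with `a ω = 1`, supported where `e` vanishes, kills `e`, hence kills `θ e`.
-/
lemma IsLocal.value_eq_zero_of_eventually {θ : E →ₗ[ℂ] F} (hloc : IsLocal Ω θ) {e : E} {ω : Ω}
    (h : ∀ᶠ η in 𝓝 ω, value e η = 0) : value (θ e) ω = 0 := by
  obtain ⟨a, ha₁, ha₀⟩ := exists_zeroAtInfty_bump h
  have hae : a • e = 0 := by
    refine ext_value Ω fun η => ?_
    rw [value_module_smul, value_zero]
    by_cases hη : value e η = 0
    · rw [hη, smul_zero]
    · rw [ha₀ η hη, zero_smul]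
  have := congrArg (fun f => value f ω) (hloc e a hae)
  simpa only [value_module_smul, ha₁, one_smul, value_zero] using this

/-- A local linear map sends sections vanishing at `ω` to sections vanishing at `ω`. -/
lemma IsLocal.normSqAt_eq_zero [CompleteSpace E] {θ : E →ₗ[ℂ] F} (hloc : IsLocal Ω θ) {e : E}
    {ω : Ω} (he : normSqAt e ω = 0) : normSqAt (θ e) ω = 0 := by
  have hN := continuous_normSqAt (Ω := Ω) e
  by_contra hne
  have hδ : 0 < normSqAt (θ e) ω := lt_of_le_of_ne (normSqAt_nonneg _ _) (Ne.symm hne)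
  obtain ⟨x, hx⟩ := exists_value_eq_staircase_smul (Ω := Ω) e le_rfl zero_le_one
  obtain ⟨y, hy⟩ := exists_value_eq_staircase_smul (Ω := Ω) e (c := 1 / 2) (by norm_num)
    (by norm_num)
  -- On a plateau of height `k` the section `z` agrees with `k e` near `η`, so locality gives
  -- `θ(z)(η) = k θ(e)(η)`.
  have key : ∀ (c : ℝ) (z : E),
      (∀ η : Ω, value z η = (staircase ((√√(normSqAt e η))⁻¹ + c) : ℂ) • value e η) →
      ∀ η : Ω, normSqAt e η ≠ 0 →
      (∀ᶠ v in 𝓝 ((√√(normSqAt e η))⁻¹ + c),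
        staircase v = staircase ((√√(normSqAt e η))⁻¹ + c)) →
      staircase ((√√(normSqAt e η))⁻¹ + c) ^ 2 * normSqAt (θ e) η ≤ ‖θ z‖ ^ 2 := by
    intro c z hz η hη hev
    set k := staircase ((√√(normSqAt e η))⁻¹ + c)
    have hpos : 0 < normSqAt e η := lt_of_le_of_ne (normSqAt_nonneg _ _) (Ne.symm hη)
    have hcont : ContinuousAt (fun η : Ω => (√√(normSqAt e η))⁻¹ + c) η :=
      ((by fun_prop : Continuous fun η : Ω => √√(normSqAt e η)).continuousAt.inv₀
        (by positivity)).add continuousAt_const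
    have hzero : ∀ᶠ ζ in 𝓝 η, value (z - (k : ℂ) • e) ζ = 0 := by
      filter_upwards [hcont.eventually hev] with ζ hζ
      rw [value_sub, value_smul, hz ζ, hζ, sub_self]
    have hθ := hloc.value_eq_zero_of_eventually hzero
    rw [map_sub, map_smul, value_sub, value_smul, sub_eq_zero] at hθ
    rw [← normSqAt_of_value_eq_real_smul hθ]
    exact normSqAt_le_norm_sq _ η
  set M := ‖θ x‖ ^ 2 + ‖θ y‖ ^ 2
  -- At each `η` one of the two shifts sits on a plateau, so `M` bounds both cases. The hypothesis
  -- `1 ≤ |e|^(-1/2)` keeps the base nonnegative for squaring.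
  have hbound : ∀ η : Ω, normSqAt e η ≠ 0 → 1 ≤ (√√(normSqAt e η))⁻¹ →
      ((√√(normSqAt e η))⁻¹ - 1) ^ 2 * normSqAt (θ e) η ≤ M := by
    intro η hη h₁
    have hmono : ∀ c : ℝ, 0 ≤ c → ((√√(normSqAt e η))⁻¹ - 1) ^ 2 * normSqAt (θ e) η ≤
        staircase ((√√(normSqAt e η))⁻¹ + c) ^ 2 * normSqAt (θ e) η := fun c hc =>
      mul_le_mul_of_nonneg_right (pow_le_pow_left₀ (by linarith)
        (by linarith [sub_one_le_staircase ((√√(normSqAt e η))⁻¹ + c)]) 2) (normSqAt_nonneg _ _)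
    rcases eventually_staircase_eq_or ((√√(normSqAt e η))⁻¹) with h | h
    · exact ((hmono 0 le_rfl).trans (key 0 x hx η hη h)).trans
        (le_add_of_nonneg_right (sq_nonneg _))
    · exact ((hmono (1 / 2) (by norm_num)).trans
        (key (1 / 2) y (by exact_mod_cast hy) η hη h)).trans (le_add_of_nonneg_left (sq_nonneg _))
  obtain ⟨B, hB⟩ := exists_gt (M / (normSqAt (θ e) ω / 2))
  have hM : 0 ≤ M := by positivity
  have hB₀ : 0 < B := lt_of_le_of_lt (by positivity) hB
  rw [div_lt_iff₀ (by positivity)] at hB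
  -- If `e(η) ≠ 0` with `η` near `ω`, then `|e(η)|^(-1/2) > B + 2`, so its square after subtracting
  -- `1` exceeds `B`, and `hbound` contradicts the choice of `B`. Thus `e` vanishes near `ω`, where
  -- plain locality applies.
  have hev : ∀ᶠ η in 𝓝 ω, normSqAt e η = 0 := by
    have h₁ : ∀ᶠ η in 𝓝 ω, √√(normSqAt e η) * (B + 2) < 1 := by
      have hc : Continuous fun η : Ω => √√(normSqAt e η) * (B + 2) := by fun_prop
      exact hc.continuousAt.eventually_lt_const (by simp [he])
    have h₂ : ∀ᶠ η in 𝓝 ω, normSqAt (θ e) ω / 2 < normSqAt (θ e) η :=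
      (continuous_normSqAt (θ e)).continuousAt.eventually_const_lt (half_lt_self hδ)
    filter_upwards [h₁, h₂] with η h₁ h₂
    by_contra hη
    have hpos : 0 < normSqAt e η := lt_of_le_of_ne (normSqAt_nonneg _ _) (Ne.symm hη)
    have hr : 0 < √√(normSqAt e η) := by positivity
    have hu : B + 2 < (√√(normSqAt e η))⁻¹ := by
      rw [lt_inv_comm₀ (by positivity) hr, lt_inv_comm₀ hr (by positivity)]
      rwa [← one_div, lt_div_iff₀ hr, mul_comm]
    have hle := hbound η hη (by linarith)
    have h₃ : B ≤ ((√√(normSqAt e η))⁻¹ - 1) ^ 2 := by nlinarith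
    have h₄ : B * (normSqAt (θ e) ω / 2) ≤ ((√√(normSqAt e η))⁻¹ - 1) ^ 2 * normSqAt (θ e) η :=
      mul_le_mul h₃ h₂.le (by positivity) (sq_nonneg _)
    linarith
  exact hne (value_eq_zero_iff.1 (hloc.value_eq_zero_of_eventually
    (hev.mono fun η hη => value_eq_zero_iff.2 hη)))

lemma IsLocal.value_congr [CompleteSpace E] {θ : E →ₗ[ℂ] F} (hloc : IsLocal Ω θ) {x y : E}
    {ω : Ω} (h : value x ω = value y ω) : value (θ x) ω = value (θ y) ω := by
  rw [value_eq_iff, ← map_sub]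
  exact hloc.normSqAt_eq_zero (value_eq_iff.1 h)

/-- At `ω`, the section `a • x` has the same value as the scalar multiple `a ω • x`, and `θ`
respects values and complex scalars. -/
lemma IsLocal.map_module_smul [CompleteSpace E] {θ : E →ₗ[ℂ] F} (hloc : IsLocal Ω θ)
    (a : C₀(Ω, ℂ)) (x : E) : θ (a • x) = a • θ x := by
  refine ext_value Ω fun ω => ?_
  rw [value_module_smul, ← value_smul, ← map_smul]
  exact hloc.value_congr (by rw [value_module_smul, value_smul])

end Local

/-- At each point of `Ω` some section of a full Hilbert module does not vanish. -/
lemma IsFull.exists_normSqAt_pos {Ω F : Type*} [TopologicalSpace Ω] [LocallyCompactSpace Ω]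
    [T2Space Ω] [NormedAddCommGroup F] [NormedSpace ℂ F] [SMul C₀(Ω, ℂ) F]
    [CStarModule C₀(Ω, ℂ) F] (hF : IsFull Ω F) (ω : Ω) : ∃ f : F, 0 < normSqAt f ω := by
  by_contra! h
  have hzero : ∀ f : F, normSqAt f ω = 0 := fun f => le_antisymm (h f) (normSqAt_nonneg f ω)
  have hclosed : IsClosed {a : C₀(Ω, ℂ) | a ω = 0} := by
    have hc : Continuous fun a : C₀(Ω, ℂ) => a ω :=
      (continuous_eval_const (F := Ω →ᵇ ℂ) ω).comp
        ZeroAtInftyContinuousMap.isometry_toBCF.continuous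
    exact isClosed_eq hc continuous_const
  have hspan : ((Submodule.span ℂ {f : C₀(Ω, ℂ) | ∃ x y : F, inner C₀(Ω, ℂ) x y = f} :
      Submodule ℂ C₀(Ω, ℂ)) : Set C₀(Ω, ℂ)) ⊆ {a : C₀(Ω, ℂ) | a ω = 0} := by
    intro a ha
    induction ha using Submodule.span_induction with
    | mem a ha =>
      obtain ⟨x, y, rfl⟩ := ha
      exact inner_apply_eq_zero_of_left (hzero x) y
    | zero => rfl
    | add a b _ _ ha hb =>
      change a ω + b ω = 0
      rw [show a ω = 0 from ha, show b ω = 0 from hb, add_zero]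
    | smul c a _ ha =>
      change c • a ω = 0
      rw [show a ω = 0 from ha, smul_zero]
  obtain ⟨a, ha, -⟩ := exists_zeroAtInfty_bump (univ_mem : Set.univ ∈ 𝓝 ω)
  have ha₀ : a ω = 0 := closure_minimal hspan hclosed (hF a)
  rw [ha] at ha₀
  exact one_ne_zero ha₀

/-! ### Orthogonality in the fibres and the scaling factor -/

section Orthogonality

variable {Ω E F : Type*} [TopologicalSpace Ω] [LocallyCompactSpace Ω] [T2Space Ω]
  [NormedAddCommGroup E] [NormedSpace ℂ E] [CompleteSpace E]
  [SMul C₀(Ω, ℂ) E] [CStarModule C₀(Ω, ℂ) E]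
  [NormedAddCommGroup F] [NormedSpace ℂ F] [SMul C₀(Ω, ℂ) F] [CStarModule C₀(Ω, ℂ) F]
  {θ : E →ₗ[ℂ] F}

/-- The maps between fibres induced by a local orthogonality preserving map preserve
orthogonality. -/
lemma PreservesOrthogonality.inner_apply_eq_zero (horth : PreservesOrthogonality Ω θ)
    (hloc : IsLocal Ω θ) {x y : E} {ω : Ω} (h : inner C₀(Ω, ℂ) x y ω = 0) :
    inner C₀(Ω, ℂ) (θ x) (θ y) ω = 0 := by
  by_cases hx : normSqAt x ω = 0
  · exact inner_apply_eq_zero_of_left (hloc.normSqAt_eq_zero hx) _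
  -- Gram–Schmidt without division: this section is orthogonal to `x` over all of `Ω`, and at `ω` it
  -- is a nonzero multiple of `y`.
  have hz : inner C₀(Ω, ℂ) x (inner C₀(Ω, ℂ) x x • y - inner C₀(Ω, ℂ) x y • x) = 0 := by
    rw [CStarModule.inner_sub_right, CStarModule.inner_op_smul_right,
      CStarModule.inner_op_smul_right, mul_comm, sub_self]
  have hθ := DFunLike.congr_fun (horth _ _ hz) ω
  rw [map_sub, hloc.map_module_smul, hloc.map_module_smul, CStarModule.inner_sub_right,
    CStarModule.inner_op_smul_right, CStarModule.inner_op_smul_right,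
    ZeroAtInftyContinuousMap.sub_apply, ZeroAtInftyContinuousMap.mul_apply,
    ZeroAtInftyContinuousMap.mul_apply, h, zero_mul, sub_zero, inner_self_apply] at hθ
  exact (mul_eq_zero.1 hθ).resolve_left (Complex.ofReal_ne_zero.2 hx)

/-- Rescaled to the equal-length vectors `|y| x` and `|x| y`, orthogonal vectors have orthogonal sum
and difference. Their images do as well, which forces the images to have equal length. -/
lemma PreservesOrthogonality.normSqAt_mul_of_inner_eq_zero (horth : PreservesOrthogonality Ω θ)
    (hloc : IsLocal Ω θ) {x y : E} {ω : Ω} (h : inner C₀(Ω, ℂ) x y ω = 0) :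
    normSqAt (θ x) ω * normSqAt y ω = normSqAt (θ y) ω * normSqAt x ω := by
  have h' : inner C₀(Ω, ℂ) y x ω = 0 := by rw [inner_star_apply, h, star_zero]
  have hθ := horth.inner_apply_eq_zero hloc h
  have hθ' := horth.inner_apply_eq_zero hloc h'
  set p : ℂ := (√(normSqAt x ω) : ℂ) with hp
  set q : ℂ := (√(normSqAt y ω) : ℂ) with hq
  have hpp : p * p = (normSqAt x ω : ℂ) := by
    rw [hp, ← Complex.ofReal_mul, Real.mul_self_sqrt (normSqAt_nonneg _ _)]
  have hqq : q * q = (normSqAt y ω : ℂ) := by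
    rw [hq, ← Complex.ofReal_mul, Real.mul_self_sqrt (normSqAt_nonneg _ _)]
  have hps : star p = p := Complex.conj_ofReal _
  have hqs : star q = q := Complex.conj_ofReal _
  have huv : inner C₀(Ω, ℂ) (q • x + p • y) (q • x - p • y) ω = 0 := by
    simp only [CStarModule.inner_sub_right, CStarModule.inner_add_left,
      CStarModule.inner_smul_right_complex, CStarModule.inner_smul_left_complex,
      ZeroAtInftyContinuousMap.sub_apply, ZeroAtInftyContinuousMap.add_apply,
      ZeroAtInftyContinuousMap.smul_apply, smul_eq_mul, inner_self_apply, h, h', hps, hqs]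
    linear_combination (normSqAt x ω : ℂ) * hqq - (normSqAt y ω : ℂ) * hpp
  have hθuv := horth.inner_apply_eq_zero hloc huv
  simp only [map_add, map_sub, map_smul, CStarModule.inner_sub_right, CStarModule.inner_add_left,
    CStarModule.inner_smul_right_complex, CStarModule.inner_smul_left_complex,
    ZeroAtInftyContinuousMap.sub_apply, ZeroAtInftyContinuousMap.add_apply,
    ZeroAtInftyContinuousMap.smul_apply, smul_eq_mul, inner_self_apply, hθ, hθ', hps, hqs] at hθuv
  have : (normSqAt (θ x) ω : ℂ) * normSqAt y ω = normSqAt (θ y) ω * normSqAt x ω := by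
    linear_combination hθuv - (normSqAt (θ x) ω : ℂ) * hqq + (normSqAt (θ y) ω : ℂ) * hpp
  exact_mod_cast this

/-- A local orthogonality preserving map scales all norms in a fibre by the same factor. -/
lemma PreservesOrthogonality.normSqAt_mul (horth : PreservesOrthogonality Ω θ)
    (hloc : IsLocal Ω θ) (x y : E) (ω : Ω) :
    normSqAt (θ x) ω * normSqAt y ω = normSqAt (θ y) ω * normSqAt x ω := by
  by_cases hx : normSqAt x ω = 0
  · rw [hx, hloc.normSqAt_eq_zero hx, zero_mul, mul_zero]
  set p := normSqAt x ω with hp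
  set c := inner C₀(Ω, ℂ) x y ω with hc
  -- At `ω` this is `p` times the component of `y` orthogonal to `x`. Pythagoras for `p y = w + c x`
  -- and for its image reduces the claim to the orthogonal pair `x`, `w`.
  set w := (p : ℂ) • y - c • x with hw
  have hxw : inner C₀(Ω, ℂ) x w ω = 0 := by
    simp only [hw, CStarModule.inner_sub_right, CStarModule.inner_smul_right_complex,
      ZeroAtInftyContinuousMap.sub_apply, ZeroAtInftyContinuousMap.smul_apply, smul_eq_mul,
      inner_self_apply, ← hp, ← hc]
    ring
  have hwx : inner C₀(Ω, ℂ) w x ω = 0 := by rw [inner_star_apply, hxw, star_zero]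
  have hθwx := horth.inner_apply_eq_zero hloc hwx
  have hy : (p : ℂ) • y = w + c • x := (sub_add_cancel _ _).symm
  have h₁ : p ^ 2 * normSqAt y ω = normSqAt w ω + ‖c‖ ^ 2 * p := by
    have := normSqAt_add w (c • x) ω
    rw [← hy, normSqAt_smul, normSqAt_smul, CStarModule.inner_smul_right_complex,
      ZeroAtInftyContinuousMap.smul_apply, hwx] at this
    simpa using this
  have h₂ : p ^ 2 * normSqAt (θ y) ω = normSqAt (θ w) ω + ‖c‖ ^ 2 * normSqAt (θ x) ω := by
    have := normSqAt_add (θ w) (c • θ x) ω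
    rw [← map_smul, ← map_add, ← hy, map_smul, map_smul, normSqAt_smul, normSqAt_smul,
      CStarModule.inner_smul_right_complex, ZeroAtInftyContinuousMap.smul_apply, hθwx] at this
    simpa using this
  have h₃ := horth.normSqAt_mul_of_inner_eq_zero hloc hxw
  refine mul_left_cancel₀ (pow_ne_zero 2 hx) ?_
  linear_combination normSqAt (θ x) ω * h₁ - p * h₂ + h₃

/-- The fibrewise scaling factor of a surjective local orthogonality preserving map onto a full
module is a continuous positive function. -/
lemma exists_continuous_scaling (hF : IsFull Ω F) (hsurj : Function.Surjective θ)
    (hloc : IsLocal Ω θ) (horth : PreservesOrthogonality Ω θ) :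
    ∃ ψ : Ω → ℝ, Continuous ψ ∧ (∀ ω, 0 < ψ ω) ∧
      ∀ x ω, normSqAt (θ x) ω = ψ ω ^ 2 * normSqAt x ω := by
  -- Fullness gives a section of `F` nonzero at `ω`; a preimage is nonzero there too, since `θ`
  -- preserves vanishing at `ω`.
  have hex : ∀ ω : Ω, ∃ e : E, 0 < normSqAt e ω ∧ 0 < normSqAt (θ e) ω := by
    intro ω
    obtain ⟨f, hf⟩ := hF.exists_normSqAt_pos ω
    obtain ⟨e, rfl⟩ := hsurj f
    exact ⟨e, lt_of_le_of_ne (normSqAt_nonneg _ _)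
      fun h => hf.ne' (hloc.normSqAt_eq_zero h.symm), hf⟩
  choose e he hθe using hex
  have hratio : ∀ x ω, 0 < normSqAt x ω →
      normSqAt (θ (e ω)) ω / normSqAt (e ω) ω = normSqAt (θ x) ω / normSqAt x ω :=
    fun x ω hx => (div_eq_div_iff (he ω).ne' hx.ne').2 (horth.normSqAt_mul hloc _ _ ω)
  refine ⟨fun ω => √(normSqAt (θ (e ω)) ω / normSqAt (e ω) ω), ?_,
    fun ω => Real.sqrt_pos.2 (div_pos (hθe ω) (he ω)), fun x ω => ?_⟩
  · rw [continuous_iff_continuousAt]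
    intro ω
    -- The ratio does not depend on the section, so near `ω` the single section `e ω` computes it.
    have hc : ContinuousAt (fun η => √(normSqAt (θ (e ω)) η / normSqAt (e ω) η)) ω :=
      ((continuous_normSqAt _).continuousAt.div (continuous_normSqAt _).continuousAt
        (he ω).ne').sqrt
    refine hc.congr ?_
    filter_upwards [(continuous_normSqAt (e ω)).continuousAt.eventually_const_lt (he ω)] with η hη
    rw [hratio _ η hη]
  · rw [Real.sq_sqrt (div_pos (hθe ω) (he ω)).le, div_mul_eq_mul_div, eq_div_iff (he ω).ne']
    exact horth.normSqAt_mul hloc _ _ ω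

end Orthogonality

/-! ### Boundedness and division by the scaling factor -/

section Scaling

variable {Ω E F : Type*} [TopologicalSpace Ω]
  [NormedAddCommGroup E] [NormedSpace ℂ E] [SMul C₀(Ω, ℂ) E] [CStarModule C₀(Ω, ℂ) E]
  [NormedAddCommGroup F] [NormedSpace ℂ F] [SMul C₀(Ω, ℂ) F] [CStarModule C₀(Ω, ℂ) F]
  {θ : E →ₗ[ℂ] F}

/-- Closed graph theorem: limits in `F` are identified one fibre at a time, so only the finiteness
of each `φ ω` matters, not a uniform bound. -/
lemma continuous_of_normSqAt_eq [CompleteSpace E] [CompleteSpace F] {φ : Ω → ℝ}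
    (h : ∀ x ω, normSqAt (θ x) ω = φ ω * normSqAt x ω) : Continuous θ := by
  refine θ.continuous_of_seq_closed_graph fun u x y hu hθu => ext_value Ω fun ω => ?_
  rw [value_eq_iff]
  refine le_antisymm (ge_of_tendsto (x := atTop)
    (f := fun n => 2 * ‖y - θ (u n)‖ ^ 2 + 2 * (|φ ω| * ‖u n - x‖ ^ 2)) ?_
    (Eventually.of_forall fun n => ?_)) (normSqAt_nonneg _ ω)
  · have h₁ := (((tendsto_const_nhds (x := y)).sub hθu).norm.pow 2).const_mul 2
    have h₂ := (((hu.sub (tendsto_const_nhds (x := x))).norm.pow 2).const_mul |φ ω|).const_mul 2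
    simpa using h₁.add h₂
  · have h₁ := normSqAt_add_le (y - θ (u n)) (θ (u n - x)) ω
    rw [map_sub, sub_add_sub_cancel, ← map_sub, h] at h₁
    have h₂ := normSqAt_le_norm_sq (y - θ (u n)) ω
    have h₃ : φ ω * normSqAt (u n - x) ω ≤ |φ ω| * ‖u n - x‖ ^ 2 :=
      mul_le_mul (le_abs_self _) (normSqAt_le_norm_sq _ ω) (normSqAt_nonneg _ _) (abs_nonneg _)
    linarith

/-- Polarization: norms of sums give the real parts, and replacing `y` by `Complex.I • y` gives the
imaginary parts. -/
lemma inner_map_map_of_normSqAt_eq {U : E →ₗ[ℂ] F}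
    (h : ∀ x (ω : Ω), normSqAt (U x) ω = normSqAt x ω) (x y : E) :
    inner C₀(Ω, ℂ) (U x) (U y) = inner C₀(Ω, ℂ) x y := by
  have hre : ∀ (x y : E) (ω : Ω),
      (inner C₀(Ω, ℂ) (U x) (U y) ω).re = (inner C₀(Ω, ℂ) x y ω).re := by
    intro x y ω
    have h₁ := normSqAt_add (U x) (U y) ω
    rw [← map_add, h, h, h, normSqAt_add] at h₁
    linarith
  ext ω
  refine Complex.ext (hre x y ω) ?_
  have h₂ := hre x (Complex.I • y) ω
  rw [map_smul] at h₂
  simpa using h₂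

lemma norm_map_of_normSqAt_eq {U : E →ₗ[ℂ] F}
    (h : ∀ x (ω : Ω), normSqAt (U x) ω = normSqAt x ω) (x : E) : ‖U x‖ = ‖x‖ := by
  rw [CStarModule.norm_eq_sqrt_norm_inner_self (A := C₀(Ω, ℂ)),
    inner_map_map_of_normSqAt_eq h, ← CStarModule.norm_eq_sqrt_norm_inner_self (A := C₀(Ω, ℂ))]

lemma isUnitary_of_normSqAt_eq {U : E →ₗ[ℂ] F}
    (h : ∀ x (ω : Ω), normSqAt (U x) ω = normSqAt x ω)
    (hmod : ∀ (a : C₀(Ω, ℂ)) (x : E), U (a • x) = a • U x) (hsurj : Function.Surjective U) :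
    IsUnitary Ω U := by
  have hnorm := norm_map_of_normSqAt_eq h
  have hinj : Function.Injective U :=
    (injective_iff_map_eq_zero U).2 fun x hx => by
      rw [← norm_eq_zero, ← hnorm, hx, norm_zero]
  let W := LinearEquiv.ofBijective U ⟨hinj, hsurj⟩
  have hUW : ∀ y, U (W.symm y) = y := W.apply_symm_apply
  refine ⟨⟨⟨1, fun x => by rw [hnorm, one_mul]⟩, hmod⟩, W.symm.toLinearMap,
    ⟨⟨1, fun y => ?_⟩, fun a y => hinj ?_⟩, fun x y => ?_, ?_, ?_⟩
  · rw [one_mul, LinearEquiv.coe_coe, ← hnorm, hUW]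
  · rw [hmod, LinearEquiv.coe_coe, hUW, hUW]
  · rw [← inner_map_map_of_normSqAt_eq h, LinearEquiv.coe_coe, hUW]
  · exact LinearMap.ext W.symm_apply_apply
  · exact LinearMap.ext hUW

/-- Dividing a module homomorphism by its fibrewise scaling factor. -/
lemma exists_isUnitary_of_scaling [CompleteSpace F] (hsurj : Function.Surjective θ)
    (hmod : ∀ (a : C₀(Ω, ℂ)) (x : E), θ (a • x) = a • θ x) (ψ : Ω →ᵇ ℝ) {c : ℝ} (hc : 0 < c)
    (hψ : ∀ ω, c ≤ ψ ω) (hscale : ∀ x ω, normSqAt (θ x) ω = ψ ω ^ 2 * normSqAt x ω) :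
    ∃ U : E →ₗ[ℂ] F, IsUnitary Ω U ∧
      ∀ e ω, value (θ e) ω = (ψ ω : ℂ) • value (U e) ω := by
  have hpos : ∀ ω, 0 < ψ ω := fun ω => hc.trans_le (hψ ω)
  have hne : ∀ ω, (ψ ω : ℂ) ≠ 0 := fun ω => Complex.ofReal_ne_zero.2 (hpos ω).ne'
  -- The lower bound `c` makes `1/ψ` bounded, so `ψ⁻¹ · θ(e)` is a genuine element of `F`.
  have hex : ∀ e : E, ∃ z : F, ∀ ω, value z ω = (((ψ ω)⁻¹ : ℝ) : ℂ) • value (θ e) ω := by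
    intro e
    refine exists_value_eq_smul_of_bounded (θ e) (C := c⁻¹)
      (ψ.continuous.inv₀ fun ω => (hpos ω).ne') fun ω => ?_
    rw [abs_of_pos (inv_pos.2 (hpos ω))]
    exact inv_anti₀ hc (hψ ω)
  choose u hu using hex
  let U : E →ₗ[ℂ] F :=
    { toFun := u
      map_add' := fun x y => ext_value Ω fun ω => by
        rw [value_add, hu, hu, hu, map_add, value_add, smul_add]
      map_smul' := fun k x => ext_value Ω fun ω => by
        rw [RingHom.id_apply, value_smul, hu, hu, map_smul, value_smul, smul_comm] }
  have hU : ∀ e ω, value (θ e) ω = (ψ ω : ℂ) • value (U e) ω := fun e ω => by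
    change _ = (ψ ω : ℂ) • value (u e) ω
    rw [hu, smul_smul, Complex.ofReal_inv, mul_inv_cancel₀ (hne ω), one_smul]
  refine ⟨U, isUnitary_of_normSqAt_eq (fun x ω => ?_) (fun a x => ?_) (fun y => ?_), hU⟩
  · have h := normSqAt_of_value_eq_real_smul (hU x ω)
    rw [hscale] at h
    exact (mul_left_cancel₀ (pow_ne_zero 2 (hpos ω).ne') h).symm
  · refine ext_value Ω fun ω => ?_
    change value (u (a • x)) ω = value (a • u x) ω
    rw [value_module_smul, hu, hu, hmod, value_module_smul, smul_comm]
  -- The upper bound on `ψ` puts `ψ · y` in `F`; any `θ`-preimage of it is a `U`-preimage of `y`.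
  · obtain ⟨z, hz⟩ := exists_value_eq_smul_of_bounded y ψ.continuous (C := ‖ψ‖)
      fun ω => ψ.norm_coe_le_norm ω
    obtain ⟨x, rfl⟩ := hsurj z
    refine ⟨x, ext_value Ω fun ω => ?_⟩
    change value (u x) ω = _
    rw [hu, hz, smul_smul, Complex.ofReal_inv, inv_mul_cancel₀ (hne ω), one_smul]

end Scaling

end HilbertC0

/-! ### The main theorem -/

theorem corollary3p9 {Ω E F : Type*} [TopologicalSpace Ω] [LocallyCompactSpace Ω] [T2Space Ω]
    [NormedAddCommGroup E] [NormedSpace ℂ E] [CompleteSpace E]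
    [SMul C₀(Ω, ℂ) E] [CStarModule C₀(Ω, ℂ) E]
    [NormedAddCommGroup F] [NormedSpace ℂ F] [CompleteSpace F]
    [SMul C₀(Ω, ℂ) F] [CStarModule C₀(Ω, ℂ) F]
    (hF : HilbertC0.IsFull Ω F)
    (θ : E →ₗ[ℂ] F)
    (hsurj : Function.Surjective θ)
    (hloc : HilbertC0.IsLocal Ω θ)
    (horth : HilbertC0.PreservesOrthogonality Ω θ) :
    θ ∈ HilbertC0.boundedModuleHoms Ω E F ∧
      ∃ (ψ : Ω →ᵇ ℝ) (U : E →ₗ[ℂ] F),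
        (∀ ω, 0 < ψ ω) ∧ HilbertC0.IsUnitary Ω U ∧
          ∀ (e : E) (ω : Ω),
            HilbertC0.value (θ e) ω = (ψ ω : ℂ) • HilbertC0.value (U e) ω := by
  open HilbertC0 in
  obtain ⟨ψ, hψc, hψ, hscale⟩ := exists_continuous_scaling hF hsurj hloc horth
  let T : E →L[ℂ] F := ⟨θ, continuous_of_normSqAt_eq hscale⟩
  have hT : ∀ x, ‖θ x‖ ≤ ‖T‖ * ‖x‖ := T.le_opNorm
  -- Open mapping theorem: preimages with norm control, which will bound `ψ` below by `K⁻¹`.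
  obtain ⟨K, hK, hpre⟩ := T.exists_preimage_norm_le hsurj
  have hupper : ∀ ω, ψ ω ≤ ‖T‖ := by
    intro ω
    obtain ⟨f, hf⟩ := hF.exists_normSqAt_pos ω
    obtain ⟨e, rfl⟩ := hsurj f
    rw [hscale] at hf
    -- A section attaining its norm at `ω` turns the operator bound for `θ` into a bound for `ψ ω`.
    obtain ⟨x, hx, hxn⟩ := exists_norm_sq_le_normSqAt (pos_of_mul_pos_right hf (sq_nonneg _))
    refine (sq_le_sq₀ (hψ ω).le (norm_nonneg _)).1 ?_
    refine le_of_mul_le_mul_right ?_ hx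
    calc ψ ω ^ 2 * normSqAt x ω = normSqAt (θ x) ω := (hscale x ω).symm
      _ ≤ ‖θ x‖ ^ 2 := normSqAt_le_norm_sq _ ω
      _ ≤ (‖T‖ * ‖x‖) ^ 2 := pow_le_pow_left₀ (norm_nonneg _) (hT x) 2
      _ = ‖T‖ ^ 2 * ‖x‖ ^ 2 := mul_pow _ _ _
      _ ≤ ‖T‖ ^ 2 * normSqAt x ω := mul_le_mul_of_nonneg_left hxn (sq_nonneg _)
  have hlower : ∀ ω, K⁻¹ ≤ ψ ω := by
    intro ω
    obtain ⟨f, hf⟩ := hF.exists_normSqAt_pos ω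
    obtain ⟨y, hy, hyn⟩ := exists_norm_sq_le_normSqAt hf
    obtain ⟨x, rfl, hxn⟩ := hpre y
    rw [inv_le_iff_one_le_mul₀ hK]
    refine (sq_le_sq₀ zero_le_one (mul_nonneg (hψ ω).le hK.le)).1 ?_
    refine le_of_mul_le_mul_right ?_ hy
    calc 1 ^ 2 * normSqAt (T x) ω = ψ ω ^ 2 * normSqAt x ω := by
          rw [one_pow, one_mul]; exact hscale x ω
      _ ≤ ψ ω ^ 2 * (K * ‖T x‖) ^ 2 := mul_le_mul_of_nonneg_left
          ((normSqAt_le_norm_sq _ ω).trans (pow_le_pow_left₀ (norm_nonneg _) hxn 2)) (sq_nonneg _)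
      _ = (ψ ω * K) ^ 2 * ‖T x‖ ^ 2 := by ring
      _ ≤ (ψ ω * K) ^ 2 * normSqAt (T x) ω := mul_le_mul_of_nonneg_left hyn (sq_nonneg _)
  let Ψ : Ω →ᵇ ℝ := BoundedContinuousFunction.ofNormedAddCommGroup ψ hψc ‖T‖ fun ω => by
    rw [Real.norm_of_nonneg (hψ ω).le]
    exact hupper ω
  obtain ⟨U, hU, hval⟩ := exists_isUnitary_of_scaling hsurj hloc.map_module_smul Ψ
    (inv_pos.2 hK) hlower hscale
  exact ⟨⟨⟨‖T‖, hT⟩, hloc.map_module_smul⟩, Ψ, U, hψ, hU, hval⟩
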